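/- Let $R$ be an associative ring with $1$ (not necessarily commutative), and assume: (a) $R$ is \emph{left Warfield}: every finitely presented left $R$-module is a direct summand of a direct sum of cyclic finitely presented left $R$-modules; (b) $R$ is \emph{right $\aleph_0$-injective}: every homomorphism of right modules $I\to R_R$ from a finitely generated right ideal $I$ of $R$ extends to a homomorphism $R_R\to R_R$; (c) $R$ is \emph{right a-coherent}: for every unary left pp formula $\phi(x)$, i.e. every formula of the form $\exists \bar y\,(A\bar y = \bar b\,x)$ with $A$ a matrix and $\bar b$ a column vector over $R$, the right ideal $I=\phi({}_RR)=\{r\in R : \exists \bar y \text{ over } R,\ A\bar y=\bar b\,r\}$ contains a finitely generated right ideal $I_0$ with the same left annihilator, $\{r : rI=0\}=\{r : rI_0=0\}$. Then $R$ is right absolutely pure, i.e. the right module $R_R$ is pure in every right $R$-module containing it (where $P\subseteq N$ is pure if every tuple of elements of $P$ that satisfies a pp formula $\exists\bar y\,(\bar y\,C=\bar x\,D)$, with $C$, $D$ matrices over $R$, in $N$ satisfies it in $P$). Hence $R$ is also left IF, i.e. every injective left $R$-module is flat. -/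

import Mathlib

universe u v w

open scoped TensorProduct DirectSum

/-! Right modules over `R` are modules over the opposite ring `Rᵐᵒᵖ`, with
`MulOpposite.op r • x` standing for `x r`. Thus right ideals of `R` are elements of
`Submodule Rᵐᵒᵖ R`. -/

namespace PPRing

/-- A positive primitive formula `∃ y, A y = B x` in `n` free variables, for left `R`-modules. -/
structure PPFormula (R : Type u) (n : ℕ) where
  numEq : ℕ
  numEx : ℕ
  A : Matrix (Fin numEq) (Fin numEx) R
  B : Matrix (Fin numEq) (Fin n) R

/-- The tuple `x` satisfies the pp formula `∃ y, A y = B x` in the module `M`. -/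
def PPFormula.Realize {R : Type u} [Ring R] {n : ℕ} (φ : PPFormula R n)
    {M : Type v} [AddCommGroup M] [Module R M] (x : Fin n → M) : Prop :=
  ∃ y : Fin φ.numEx → M, ∀ i, ∑ j, φ.A i j • y j = ∑ j, φ.B i j • x j

/-- The right ideal that a unary left pp formula defines in the left module `R`. -/
def PPFormula.rightIdeal {R : Type u} [Ring R] (φ : PPFormula R 1) : Submodule Rᵐᵒᵖ R where
  carrier := {r | φ.Realize (fun _ => r)}
  add_mem' := by
    rintro a b ⟨y, hy⟩ ⟨z, hz⟩
    refine ⟨y + z, fun i => ?_⟩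
    simp only [Pi.add_apply, smul_add, Finset.sum_add_distrib, hy i, hz i]
  zero_mem' := ⟨0, fun i => by simp⟩
  smul_mem' := by
    rintro c a ⟨y, hy⟩
    refine ⟨c • y, fun i => ?_⟩
    simp only [Pi.smul_apply, smul_comm _ c, ← Finset.smul_sum, hy i]

/-- The left annihilator of a subset of `R`. -/
def leftAnn {R : Type u} [Ring R] (S : Set R) : Set R := {r | ∀ s ∈ S, r * s = 0}

/-- `R` is right a-coherent: for every unary left pp formula `φ`, the right ideal `φ(R)` has the
same left annihilator as some finitely generated right ideal contained in it. -/
def IsRightACoherent (R : Type u) [Ring R] : Prop :=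
  ∀ φ : PPFormula R 1, ∃ I₀ : Submodule Rᵐᵒᵖ R, I₀ ≤ φ.rightIdeal ∧ I₀.FG ∧
    leftAnn (φ.rightIdeal : Set R) = leftAnn (I₀ : Set R)

/-- `R` is right `κ`-injective: every homomorphism to `R` from a right ideal with a generating set
of cardinality `< κ` extends to `R`. -/
def IsRightCardInjective (R : Type u) [Ring R] (κ : Cardinal.{u}) : Prop :=
  ∀ I : Submodule Rᵐᵒᵖ R,
    (∃ G : Set R, Cardinal.mk G < κ ∧ Submodule.span Rᵐᵒᵖ G = I) →
    ∀ f : I →ₗ[Rᵐᵒᵖ] R, ∃ g : R →ₗ[Rᵐᵒᵖ] R, ∀ x : I, g x = f x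

/-- `R` is left Warfield: every finitely presented left module is (isomorphic to) a direct summand
of a direct sum of cyclic finitely presented left modules. -/
def IsLeftWarfield (R : Type u) [Ring R] : Prop :=
  ∀ (M : Type u) [AddCommGroup M] [Module R M], Module.FinitePresentation R M →
    ∃ (ι : Type u) (C : ι → Type u) (_ : ∀ i, AddCommGroup (C i)) (_ : ∀ i, Module R (C i)),
      (∀ i, (⊤ : Submodule R (C i)).IsPrincipal ∧ Module.FinitePresentation R (C i)) ∧
      ∃ (s : M →ₗ[R] ⨁ i, C i) (p : (⨁ i, C i) →ₗ[R] M), p ∘ₗ s = LinearMap.id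

/-- A submodule `P` of `N` is pure: a tuple from `P` satisfying a pp formula in `N` satisfies it
in `P`. -/
def IsPure {R : Type u} [Ring R] {N : Type v} [AddCommGroup N] [Module R N]
    (P : Submodule R N) : Prop :=
  ∀ (n : ℕ) (φ : PPFormula R n) (x : Fin n → P),
    φ.Realize (fun i => (x i : N)) → φ.Realize x

/-- `M` is absolutely pure: it is pure in every module into which it embeds. -/
def IsAbsolutelyPure (R : Type u) [Ring R] (M : Type v) [AddCommGroup M] [Module R M] : Prop :=
  ∀ (N : Type (max v w)) [AddCommGroup N] [Module R N] (f : M →ₗ[R] N),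
    Function.Injective f → IsPure (LinearMap.range f)

/-- The relations `a r ⊗ m = a ⊗ r m` that turn `A ⊗[ℤ] M` into the tensor product over `R` of a
right module `A` and a left module `M`. -/
def tensorRel (R : Type u) [Ring R] (A : Type w) [AddCommGroup A] [Module Rᵐᵒᵖ A]
    (M : Type v) [AddCommGroup M] [Module R M] : AddSubgroup (A ⊗[ℤ] M) :=
  AddSubgroup.closure
    {t | ∃ (a : A) (r : R) (m : M), t = (MulOpposite.op r • a) ⊗ₜ[ℤ] m - a ⊗ₜ[ℤ] (r • m)}

/-- The tensor product over `R` of a right module `A` and a left module `M`, an abelian group. -/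
abbrev Tensor (R : Type u) [Ring R] (A : Type w) [AddCommGroup A] [Module Rᵐᵒᵖ A]
    (M : Type v) [AddCommGroup M] [Module R M] : Type (max v w) :=
  (A ⊗[ℤ] M) ⧸ tensorRel R A M

/-- The map `f ⊗ M : A ⊗ M → B ⊗ M` induced by a homomorphism `f : A → B` of right modules. -/
def tensorMap (R : Type u) [Ring R] {A B : Type w} [AddCommGroup A] [Module Rᵐᵒᵖ A]
    [AddCommGroup B] [Module Rᵐᵒᵖ B] (M : Type v) [AddCommGroup M] [Module R M]
    (f : A →ₗ[Rᵐᵒᵖ] B) : Tensor R A M →+ Tensor R B M :=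
  QuotientAddGroup.map (tensorRel R A M) (tensorRel R B M)
    (LinearMap.rTensor M f.toAddMonoidHom.toIntLinearMap).toAddMonoidHom (by
      rw [tensorRel, AddSubgroup.closure_le]
      rintro _ ⟨a, r, m, rfl⟩
      refine AddSubgroup.subset_closure ⟨f a, r, m, ?_⟩
      simp)

/-- The left module `M` is flat: `- ⊗ M` preserves injectivity of homomorphisms of right
modules. -/
def IsFlat (R : Type u) [Ring R] (M : Type v) [AddCommGroup M] [Module R M] : Prop :=
  ∀ (A B : Type (max u w)) [AddCommGroup A] [Module Rᵐᵒᵖ A] [AddCommGroup B] [Module Rᵐᵒᵖ B]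
    (f : A →ₗ[Rᵐᵒᵖ] B), Function.Injective f → Function.Injective (tensorMap R M f)

/-- `R` is left IF: every injective left module is flat. -/
def IsLeftIF (R : Type u) [Ring R] : Prop :=
  ∀ (M : Type (max u v)) [AddCommGroup M] [Module R M],
    Module.Injective R M → IsFlat.{u, max u v, w} R M

end PPRing

namespace PPRing

/-! The crux is that every finitely presented left module embeds in a free one. By the Warfield
condition it suffices to treat R/L with L a finitely generated left ideal, and R/L embeds in R^J
once L is the left annihilator of a finite set J. Such a J is found by induction on the generators
of L: a-coherence supplies it, and ℵ₀-injectivity absorbs the added generator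
(`exists_finset_annihilator`).

Coordinates separate the points of a free module, and absolute purity follows by duality for linear
systems. Moreover, a map from a finitely presented module to an injective E factors through a free
module, so E satisfies the equational criterion for one relation. This makes the character module of
E injective, whence E is flat (Lambek). -/

variable {R : Type u} [Ring R]

/-! ### Annihilators and embeddings in free modules -/

/-- The unary left pp formula `⋀_{a ∈ S} a x = 0`. -/
noncomputable def annihilatorFormula (S : Finset R) : PPFormula R 1 where
  numEq := S.card
  numEx := 0
  A := 0
  B := fun i _ => (S.equivFin.symm i : R)

theorem mem_rightIdeal_annihilatorFormula {S : Finset R} {x : R} :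
    x ∈ (annihilatorFormula S).rightIdeal ↔ ∀ a ∈ S, a * x = 0 := by
  change (annihilatorFormula S).Realize (fun _ => x) ↔ _
  constructor
  · rintro ⟨y, hy⟩ a ha
    have h := hy (S.equivFin ⟨a, ha⟩)
    simpa [annihilatorFormula] using h.symm
  · intro h
    refine ⟨0, fun i => ?_⟩
    simp only [Pi.zero_apply, smul_zero, Finset.sum_const_zero]
    simp [annihilatorFormula, h _ (S.equivFin.symm i).2]

/-- Over a right `ℵ₀`-injective ring, if `a x = 0` implies `c x = 0` on the right ideal generated
by a finite set, then on this set left multiplication by `c` is left multiplication by a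
left multiple of `a`. -/
theorem exists_mul_eq_of_isRightCardInjective
    (hinj : IsRightCardInjective R Cardinal.aleph0) (J : Finset R) (a c : R)
    (h : ∀ x ∈ Submodule.span Rᵐᵒᵖ (J : Set R), a * x = 0 → c * x = 0) :
    ∃ b : R, ∀ x ∈ J, c * x = b * a * x := by
  classical
  let g₁ := (LinearMap.mulLeft Rᵐᵒᵖ a).domRestrict (Submodule.span Rᵐᵒᵖ (J : Set R))
  let g₂ := (LinearMap.mulLeft Rᵐᵒᵖ c).domRestrict (Submodule.span Rᵐᵒᵖ (J : Set R))
  have hker : LinearMap.ker g₁ ≤ LinearMap.ker g₂ := fun x hx => h x x.2 hx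
  -- The map to extend is a x ↦ c x, defined on the right ideal generated by the finite set aJ.
  obtain ⟨g, hg⟩ := hinj (LinearMap.range g₁)
    ⟨((J.image (a * ·) : Finset R) : Set R), Cardinal.lt_aleph0_of_finite _, by
      rw [LinearMap.range_domRestrict, Submodule.map_span, Finset.coe_image]
      rfl⟩
    ((LinearMap.ker g₁).liftQ g₂ hker ∘ₗ g₁.quotKerEquivRange.symm.toLinearMap)
  -- A right linear map R → R is left multiplication by its value at 1.
  refine ⟨g 1, fun x hx => ?_⟩
  have hx' := hg ⟨_, LinearMap.mem_range_self g₁ ⟨x, Submodule.subset_span hx⟩⟩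
  have e : g₁.quotKerEquivRange.symm ⟨_, LinearMap.mem_range_self g₁ ⟨x, Submodule.subset_span hx⟩⟩
      = (LinearMap.ker g₁).mkQ ⟨x, Submodule.subset_span hx⟩ := by
    rw [LinearEquiv.symm_apply_eq]
    rfl
  rw [LinearMap.comp_apply, LinearEquiv.coe_coe, e] at hx'
  change g (a * x) = c * x at hx'
  rw [← hx', mul_assoc]
  have := g.map_smul (MulOpposite.op (a * x)) 1
  simpa using this

/-- Every finitely generated left ideal is the left annihilator of a finite set. -/
theorem exists_finset_annihilator
    (hinj : IsRightCardInjective R Cardinal.aleph0) (hcoh : IsRightACoherent R) (S : Finset R) :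
    ∃ J : Finset R, (∀ x ∈ J, ∀ a ∈ S, a * x = 0) ∧
      ∀ c : R, (∀ x ∈ J, c * x = 0) → c ∈ Submodule.span R (S : Set R) := by
  classical
  induction S using Finset.induction_on with
  | empty => exact ⟨{1}, by simp, by simp⟩
  | insert a S _ ih =>
    obtain ⟨J, hJ, hJS⟩ := ih
    obtain ⟨I₀, hI₀, ⟨J', rfl⟩, hann⟩ := hcoh (annihilatorFormula (insert a S))
    refine ⟨J', fun x hx => mem_rightIdeal_annihilatorFormula.1
      (hI₀ (Submodule.subset_span hx)), fun c hc => ?_⟩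
    -- Killing the generators of I₀, c kills the whole right annihilator of `insert a S`.
    have hc' : c ∈ leftAnn ((annihilatorFormula (insert a S)).rightIdeal : Set R) := by
      rw [hann]
      have : Submodule.span Rᵐᵒᵖ (J' : Set R) ≤
          LinearMap.ker (LinearMap.mulLeft Rᵐᵒᵖ c) := Submodule.span_le.2 hc
      exact fun s hs => this hs
    have hJ' : Submodule.span Rᵐᵒᵖ (J : Set R) ≤ (annihilatorFormula S).rightIdeal :=
      Submodule.span_le.2 fun x hx => mem_rightIdeal_annihilatorFormula.2 (hJ x hx)
    obtain ⟨b, hb⟩ := exists_mul_eq_of_isRightCardInjective hinj J a c fun x hx hax =>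
      hc' x (mem_rightIdeal_annihilatorFormula.2 fun s hs => by
        rcases Finset.mem_insert.1 hs with rfl | hs
        · exact hax
        · exact mem_rightIdeal_annihilatorFormula.1 (hJ' hx) s hs)
    have hmem := hJS (c - b * a) fun x hx => by rw [sub_mul, hb x hx, sub_self]
    rw [Finset.coe_insert, Submodule.span_insert, ← sub_add_cancel c (b * a)]
    exact add_mem (Submodule.mem_sup_right hmem)
      (Submodule.mem_sup_left (Submodule.smul_mem _ b (Submodule.mem_span_singleton_self a)))

/-- A cyclic finitely presented left module embeds in a free module of finite rank. -/
theorem exists_injective_pi_of_isPrincipal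
    (hinj : IsRightCardInjective R Cardinal.aleph0) (hcoh : IsRightACoherent R)
    (C : Type u) [AddCommGroup C] [Module R C] (hC : (⊤ : Submodule R C).IsPrincipal)
    [Module.FinitePresentation R C] :
    ∃ (J : Finset R) (f : C →ₗ[R] (J → R)), Function.Injective f := by
  obtain ⟨g, hg⟩ := hC
  let π := LinearMap.toSpanSingleton R C g
  have hπ : Function.Surjective π := by
    rw [← LinearMap.range_eq_top, LinearMap.range_toSpanSingleton, hg]
  obtain ⟨S, hS⟩ := Module.FinitePresentation.fg_ker π hπ
  obtain ⟨J, hJ, hJS⟩ := exists_finset_annihilator hinj hcoh S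
  -- The kernel of c ↦ (c x)ₓ is the left annihilator of J, that is, the span of S.
  let ρ : R →ₗ[R] (J → R) := LinearMap.pi fun x => LinearMap.toSpanSingleton R R (x : R)
  have hρ : LinearMap.ker ρ = LinearMap.ker π := by
    rw [← hS]
    apply le_antisymm
    · intro c hc
      exact hJS c fun x hx => congrFun hc ⟨x, hx⟩
    · rw [Submodule.span_le]
      intro a ha
      exact funext fun x => hJ x x.2 a ha
  refine ⟨J, (LinearMap.ker π).liftQ ρ hρ.ge ∘ₗ
    (π.quotKerEquivOfSurjective hπ).symm.toLinearMap, ?_⟩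
  rw [LinearMap.coe_comp]
  refine Function.Injective.comp ?_ (LinearEquiv.injective _)
  rw [← LinearMap.ker_eq_bot]
  exact Submodule.ker_liftQ_eq_bot _ _ _ hρ.le

/-- Every finitely presented left module embeds in a free module. -/
theorem exists_injective_free (hW : IsLeftWarfield R)
    (hinj : IsRightCardInjective R Cardinal.aleph0) (hcoh : IsRightACoherent R)
    (M : Type u) [AddCommGroup M] [Module R M] [Module.FinitePresentation R M] :
    ∃ (X : Type u) (f : M →ₗ[R] (X →₀ R)), Function.Injective f := by
  obtain ⟨ι, C, _, _, hC, s, p, hps⟩ := hW M inferInstance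
  have hemb : ∀ i, ∃ (J : Finset R) (f : C i →ₗ[R] (J → R)), Function.Injective f := fun i =>
    have := (hC i).2
    exists_injective_pi_of_isPrincipal hinj hcoh (C i) (hC i).1
  choose J f hf using hemb
  let b := Module.Free.chooseBasis R (⨁ i, (J i → R))
  refine ⟨_, b.repr.toLinearMap ∘ₗ DirectSum.lmap f ∘ₗ s, ?_⟩
  simp only [LinearMap.coe_comp]
  refine b.repr.injective.comp (((DirectSum.lmap_injective _).2 hf).comp ?_)
  exact Function.LeftInverse.injective (g := p) fun m => LinearMap.congr_fun hps m

/-! ### Absolute purity -/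

/-- A system y C = d is unsolvable in R only if d lies outside the left row span of C. Then a
coordinate of the embedded quotient gives a column c with C c = 0 and d c ≠ 0, which rules out
solutions in any overmodule too. -/
theorem isAbsolutelyPure_of_exists_injective_free
    (h : ∀ (M : Type u) [AddCommGroup M] [Module R M] [Module.FinitePresentation R M],
      ∃ (X : Type u) (f : M →ₗ[R] (X →₀ R)), Function.Injective f) :
    IsAbsolutelyPure.{u, u, w} Rᵐᵒᵖ R := by
  intro N _ _ f hf n φ x ⟨y, hy⟩
  choose r hr using fun i => (x i).2
  let d : Fin φ.numEq → R := fun i => ∑ j, r j * (φ.B i j).unop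
  let C : Fin φ.numEx → Fin φ.numEq → R := fun j i => (φ.A i j).unop
  have hd : ∀ i, ∑ j, φ.A i j • y j = f (d i) := fun i => by
    rw [hy i, map_sum]
    refine Finset.sum_congr rfl fun j _ => Eq.symm ?_
    change f (r j * (φ.B i j).unop) = φ.B i j • (x j : N)
    rw [← hr j, ← map_smul]
    rfl
  have hmem : d ∈ Submodule.span R (Set.range C) := by
    by_contra hd'
    have : Module.FinitePresentation R ((Fin φ.numEq → R) ⧸ Submodule.span R (Set.range C)) :=
      Module.finitePresentation_of_surjective (Submodule.mkQ _) (Submodule.mkQ_surjective _) (by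
        rw [Submodule.ker_mkQ]
        exact Submodule.fg_span (Set.finite_range C))
    obtain ⟨X, e, he⟩ := h ((Fin φ.numEq → R) ⧸ Submodule.span R (Set.range C))
    have hne : e (Submodule.mkQ _ d) ≠ 0 := fun h0 => hd' <| by
      rwa [map_eq_zero_iff e he, Submodule.mkQ_apply, Submodule.Quotient.mk_eq_zero] at h0
    obtain ⟨k, hk⟩ := Finsupp.ne_iff.1 hne
    let g : (Fin φ.numEq → R) →ₗ[R] R := Finsupp.lapply k ∘ₗ e ∘ₗ Submodule.mkQ _
    let c : Fin φ.numEq → R := fun i => g (Pi.single i 1)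
    have hg : ∀ z, g z = ∑ i, z i * c i := fun z => by
      conv_lhs => rw [pi_eq_sum_univ' z]
      simp [c]
    have hC : ∀ j, ∑ i, C j i * c i = 0 := fun j => by
      rw [← hg]
      have : (Submodule.span R (Set.range C)).mkQ (C j) = 0 :=
        (Submodule.Quotient.mk_eq_zero _).2 (Submodule.subset_span ⟨j, rfl⟩)
      simp only [g, LinearMap.comp_apply, this, map_zero]
    apply hk
    change g d = 0
    apply hf
    calc f (g d) = ∑ i, MulOpposite.op (c i) • f (d i) := by
          rw [hg, map_sum]
          refine Finset.sum_congr rfl fun i _ => ?_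
          rw [← map_smul]
          rfl
      _ = ∑ j, ∑ i, (MulOpposite.op (c i) * φ.A i j) • y j := by
          rw [Finset.sum_comm]
          refine Finset.sum_congr rfl fun i _ => ?_
          rw [← hd, Finset.smul_sum]
          simp only [mul_smul]
      _ = ∑ j, MulOpposite.op (∑ i, C j i * c i) • y j := by
          refine Finset.sum_congr rfl fun j _ => ?_
          rw [← Finset.sum_smul]
          congr 1
          simp [C]
      _ = f 0 := by simp [hC]
  obtain ⟨z, hz⟩ := (Submodule.mem_span_range_iff_exists_fun R).1 hmem
  refine ⟨fun j => ⟨f (z j), z j, rfl⟩, fun i => Subtype.ext ?_⟩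
  have hzi : ∑ j, φ.A i j • z j = d i := by
    rw [← hz]
    simp [C, MulOpposite.smul_eq_mul_unop]
  have hdi : f (d i) = ∑ j, φ.B i j • (x j : N) := by rw [← hd, hy]
  simp only [AddSubmonoidClass.coe_finsetSum, Submodule.coe_smul]
  rw [← hdi, ← hzi, map_sum]
  simp only [map_smul]

/-! ### Flatness of injective left modules -/

/-- The equational criterion for flatness (for one relation) holds in injective modules if
finitely presented modules embed in free modules. -/
theorem exists_factorization_of_sum_smul_eq_zero
    (h : ∀ (M : Type u) [AddCommGroup M] [Module R M] [Module.FinitePresentation R M],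
      ∃ (X : Type u) (f : M →ₗ[R] (X →₀ R)), Function.Injective f)
    {E : Type (max u v)} [AddCommGroup E] [Module R E] (hE : Module.Injective R E)
    {ι : Type u} [Fintype ι] (x : ι → R) (e : ι → E) (hxe : ∑ i, x i • e i = 0) :
    ∃ (κ : Type u) (_ : Fintype κ) (r : ι → κ → R) (e' : κ → E),
      (∀ i, e i = ∑ j, r i j • e' j) ∧ ∀ j, ∑ i, x i * r i j = 0 := by
  classical
  have : Module.FinitePresentation R ((ι → R) ⧸ Submodule.span R {x}) :=
    Module.finitePresentation_of_surjective (Submodule.mkQ _) (Submodule.mkQ_surjective _) (by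
      rw [Submodule.ker_mkQ]
      exact Submodule.fg_span_singleton x)
  obtain ⟨X, s, hs⟩ := h ((ι → R) ⧸ Submodule.span R {x})
  let g : ((ι → R) ⧸ Submodule.span R {x}) →ₗ[R] E :=
    (Submodule.span R {x}).liftQ (Fintype.linearCombination R e) (by
      rw [Submodule.span_le, Set.singleton_subset_iff]
      simpa [Fintype.linearCombination_apply] using hxe)
  obtain ⟨k, hk⟩ := (Module.Baer.of_injective hE).extension_property s hs g
  let q : ι → (X →₀ R) := fun i => s (Submodule.mkQ _ (Pi.single i 1))
  -- Only finitely many basis elements occur in the images of the generators.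
  let T : Finset X := Finset.univ.biUnion fun i => (q i).support
  have hq : ∑ i, x i • q i = 0 := by
    have : ∑ i, x i • q i = s (Submodule.mkQ _ x) := by
      simp only [q, ← map_smul, ← map_sum, ← pi_eq_sum_univ' x]
    rw [this, Submodule.mkQ_apply,
      (Submodule.Quotient.mk_eq_zero _).2 (Submodule.mem_span_singleton_self x), map_zero]
  refine ⟨T, inferInstance, fun i j => q i j, fun j => k (Finsupp.single j 1), fun i => ?_,
    fun j => ?_⟩
  · have h1 : k (q i) = e i := by
      have := LinearMap.congr_fun hk (Submodule.mkQ _ (Pi.single i 1))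
      simpa [g, q] using this
    have h2 : q i = ∑ j ∈ T, q i j • Finsupp.single j 1 := by
      conv_lhs => rw [← Finsupp.sum_single (q i)]
      rw [Finsupp.sum_of_support_subset (q i) (s := T)
        (Finset.subset_biUnion_of_mem (fun i => (q i).support) (Finset.mem_univ i)) _ (by simp)]
      simp
    rw [← h1]
    conv_lhs => rw [h2]
    rw [map_sum, ← Finset.sum_coe_sort]
    simp only [map_smul]
  · simpa using DFunLike.congr_fun hq (j : X)

/-- The right module structure on the character module of a left module. -/
noncomputable abbrev characterModuleRight (E : Type v) [AddCommGroup E] [Module R E] :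
    Module Rᵐᵒᵖ (CharacterModule E) where
  smul r z := z.comp (DistribSMul.toAddMonoidHom E r.unop)
  one_smul z := by ext e; exact congrArg z (one_smul R e)
  mul_smul r s z := by ext e; exact congrArg z (mul_smul s.unop r.unop e)
  smul_zero r := rfl
  smul_add r z z' := rfl
  add_smul r s z := by
    ext e
    exact (congrArg z (add_smul r.unop s.unop e)).trans (map_add z _ _)
  zero_smul z := by ext e; exact (congrArg z (zero_smul R e)).trans (map_zero z)

attribute [local instance] characterModuleRight

theorem characterModuleRight_smul_apply {E : Type v} [AddCommGroup E] [Module R E] (r : Rᵐᵒᵖ)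
    (z : CharacterModule E) (e : E) : (r • z) e = z (r.unop • e) := rfl

theorem baer_characterModuleRight
    (h : ∀ (M : Type u) [AddCommGroup M] [Module R M] [Module.FinitePresentation R M],
      ∃ (X : Type u) (f : M →ₗ[R] (X →₀ R)), Function.Injective f)
    {E : Type (max u v)} [AddCommGroup E] [Module R E] (hE : Module.Injective R E) :
    Module.Baer Rᵐᵒᵖ (CharacterModule E) := by
  classical
  intro I g
  -- `I →₀ E` stands in for I ⊗ E; `Φ` is the pairing through g and `μ` is multiplication into E.
  let Φ : (I →₀ E) →+ AddCircle (1 : ℚ) := Finsupp.liftAddHom fun x => (g x : E →+ _)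
  let μ : (I →₀ E) →+ E :=
    Finsupp.liftAddHom fun x => DistribSMul.toAddMonoidHom E (x : Rᵐᵒᵖ).unop
  have hker : LinearMap.ker μ.toIntLinearMap ≤ LinearMap.ker Φ.toIntLinearMap := by
    intro t ht
    have ht' : ∑ x : t.support, (x : Rᵐᵒᵖ).unop • t x = 0 := by
      rw [Finset.sum_coe_sort t.support fun x => (x : Rᵐᵒᵖ).unop • t x]
      exact ht
    obtain ⟨κ, _, r, e', he, hr⟩ := exists_factorization_of_sum_smul_eq_zero h hE
      (fun x : t.support => (x : Rᵐᵒᵖ).unop) (fun x => t x) ht'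
    change ∑ x ∈ t.support, g x (t x) = 0
    rw [← Finset.sum_coe_sort t.support fun x => g x (t x)]
    calc ∑ x : t.support, g x (t x)
        = ∑ x : t.support, ∑ j, g (MulOpposite.op (r x j) • (x : I)) (e' j) := by
          refine Finset.sum_congr rfl fun x _ => ?_
          rw [he x, map_sum]
          refine Finset.sum_congr rfl fun j _ => ?_
          rw [g.map_smul]
          rfl
      _ = ∑ j, g (∑ x : t.support, MulOpposite.op (r x j) • (x : I)) (e' j) := by
          rw [Finset.sum_comm]
          refine Finset.sum_congr rfl fun j _ => ?_
          rw [map_sum]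
          exact (AddMonoidHom.finsetSum_apply _ _ _).symm
      _ = 0 := by
          refine Finset.sum_eq_zero fun j _ => ?_
          have : ∑ x : t.support, MulOpposite.op (r x j) • (x : I) = 0 := by
            apply Subtype.ext
            apply MulOpposite.unop_injective
            simpa using hr j
          rw [this, map_zero]
          rfl
  -- By injectivity of ℚ/ℤ, `Φ` extends from the image of `μ` to a character l of E, and g is x ↦ x
  -- • l.
  obtain ⟨l, hl⟩ := CharacterModule.dual_surjective_of_injective
    ((LinearMap.ker μ.toIntLinearMap).liftQ μ.toIntLinearMap le_rfl)
    (LinearMap.ker_eq_bot.1 (Submodule.ker_liftQ_eq_bot _ _ _ le_rfl))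
    ((LinearMap.ker μ.toIntLinearMap).liftQ Φ.toIntLinearMap hker).toAddMonoidHom
  refine ⟨LinearMap.toSpanSingleton Rᵐᵒᵖ (CharacterModule E) l, fun x hx => ?_⟩
  ext e
  have := DFunLike.congr_fun hl
    ((LinearMap.ker μ.toIntLinearMap).mkQ (Finsupp.single ⟨x, hx⟩ e))
  change l (μ (Finsupp.single ⟨x, hx⟩ e)) = Φ (Finsupp.single ⟨x, hx⟩ e) at this
  exact ((congrArg l (Finsupp.liftAddHom_apply_single _ _ _)).symm.trans this).trans
    (Finsupp.liftAddHom_apply_single (fun x => (g x : E →+ AddCircle (1 : ℚ))) _ _)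

/-- A left module whose character module is injective is flat. -/
theorem isFlat_of_baer_characterModuleRight {E : Type v} [AddCommGroup E] [Module R E]
    (hE : Module.Baer Rᵐᵒᵖ (CharacterModule E)) : IsFlat.{u, v, w} R E := by
  intro A B _ _ _ _ f hf
  rw [injective_iff_map_eq_zero]
  intro t ht
  by_contra hne
  obtain ⟨c, hc⟩ := CharacterModule.exists_character_apply_ne_zero_of_ne_zero hne
  let mk (a : A) (e : E) : Tensor R A E := QuotientAddGroup.mk (a ⊗ₜ[ℤ] e)
  -- By tensor-hom adjunction, c is a map A → E⁺. Extending it along f yields a character of B ⊗ E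
  -- that restricts to c, so c vanishes at t.
  let g : A →ₗ[Rᵐᵒᵖ] CharacterModule E :=
    { toFun := fun a =>
        { toFun := fun e => c (mk a e)
          map_zero' := by simp [mk]
          map_add' := fun e e' => by
            simp only [mk, TensorProduct.tmul_add, QuotientAddGroup.mk_add, map_add] }
      map_add' := fun a a' => by
        ext e
        change c (mk (a + a') e) = c (mk a e) + c (mk a' e)
        simp only [mk, TensorProduct.add_tmul, QuotientAddGroup.mk_add, map_add]
      map_smul' := fun r a => by
        ext e
        change c (mk (r • a) e) = c (mk a (r.unop • e))
        congr 1
        rw [← sub_eq_zero]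
        change ((_ - _ : A ⊗[ℤ] E) : Tensor R A E) = 0
        rw [QuotientAddGroup.eq_zero_iff]
        exact AddSubgroup.subset_closure ⟨a, r.unop, e, rfl⟩ }
  obtain ⟨k, hk⟩ := hE.extension_property f hf g
  let K : B ⊗[ℤ] E →+ AddCircle (1 : ℚ) :=
    TensorProduct.liftAddHom
      { toFun := fun b => (k b : E →+ AddCircle (1 : ℚ))
        map_zero' := map_zero k
        map_add' := map_add k } (fun n b e => by
          change k (n • b) e = k b (n • e)
          rw [map_zsmul, map_zsmul]
          rfl)
  let K' : Tensor R B E →+ AddCircle (1 : ℚ) := QuotientAddGroup.lift _ K (by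
    rw [tensorRel, AddSubgroup.closure_le]
    rintro _ ⟨b, r, e, rfl⟩
    change K _ = 0
    rw [map_sub, sub_eq_zero]
    change k (MulOpposite.op r • b) e = k b (r • e)
    rw [map_smul]
    rfl)
  have hKc : K'.comp (tensorMap R E f) = c := by
    apply QuotientAddGroup.addMonoidHom_ext
    ext z
    induction z with
    | zero => simp only [map_zero]
    | add z z' hz hz' => simp only [map_add, hz, hz']
    | tmul a e => exact DFunLike.congr_fun (LinearMap.congr_fun hk a) e
  apply hc
  rw [← hKc]
  exact (congrArg K' ht).trans (map_zero K')

end PPRing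

theorem mainTheorem8 {R : Type u} [Ring R]
    (hW : PPRing.IsLeftWarfield R)
    (hinj : PPRing.IsRightCardInjective R Cardinal.aleph0)
    (hcoh : PPRing.IsRightACoherent R) :
    PPRing.IsAbsolutelyPure.{u, u, w} Rᵐᵒᵖ R ∧ PPRing.IsLeftIF.{u, v, w} R := by
  have h := fun (M : Type u) [AddCommGroup M] [Module R M] [Module.FinitePresentation R M] =>
    PPRing.exists_injective_free hW hinj hcoh M
  exact ⟨PPRing.isAbsolutelyPure_of_exists_injective_free h, fun _ _ _ hE =>
    PPRing.isFlat_of_baer_characterModuleRight (PPRing.baer_characterModuleRight h hE)⟩
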